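/- For every $\delta>0$ there exists $\sigma_0>0$, depending only on $\delta$, with the following property. Let $X$ be a metric length space (not necessarily geodesic or proper; the distance between two points is the infimum of the lengths of the paths joining them) which is $\delta$-hyperbolic, i.e. with $\langle x,y\rangle_t=\tfrac12\bigl(d(x,t)+d(y,t)-d(x,y)\bigr)$ one has $$\langle x,z\rangle_t\ \ge\ \min\{\langle x,y\rangle_t,\langle y,z\rangle_t\}-\delta\qquad\text{for all }x,y,z,t\in X.$$ Let $G$ be a group acting by isometries on $X$. Let $\sigma\ge\sigma_0$ and let $\mathcal R$ be a $\sigma$-rotation family, i.e. a collection of pairs $(H,v)$, where $H$ is a subgroup of $G$ and $v\in X$, such that: (R1) for every $(H,v)\in\mathcal R$, $H$ fixes $v$, and for every $x\in X$ with $d(v,x)\le\sigma/10$ and every $h\in H\setminus\{1\}$, $d(hx,x)=2d(v,x)$; (R2) if $(H,v)$ and $(H',v')$ are distinct elements of $\mathcal R$, then $d(v,v')\ge\sigma$; (R3) if $(H,v)\in\mathcal R$ and $g\in G$, then $(gHg^{-1},gv)\in\mathcal R$. Let $v(\mathcal R)$ be the set of apices, i.e. of the points $v$ with $(H,v)\in\mathcal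 R$ for some $H$, and let $K$ be the subgroup of $G$ generated by all the groups $H$ with $(H,v)\in\mathcal R$ for some $v$. Then: (1) For every $l\ge0$, every $x\in X$ such that $d(x,v)\ge l$ for all $v\in v(\mathcal R)$, and every $g\in K\setminus\{1\}$, $$d(gx,x)\ \ge\ \min\{2l,\ \sigma/10\}.$$ (2) In particular, $K$ acts freely discontinuously on $X\setminus v(\mathcal R)$: this set is $K$-invariant, and for every $x\in X\setminus v(\mathcal R)$ there is $r>0$ such that every $g\in K$ for which $gB(x,r)$ meets $B(x,r)$ is trivial, where $B(x,r)$ is the closed ball of $X$ of centre $x$ and radius $r$. -/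

import Mathlib

/-- A metric space is a length space if the distance between two points is the infimum of the
lengths (total variations) of the continuous paths joining them. -/
def IsLengthSpace (X : Type*) [MetricSpace X] : Prop :=
  ∀ x y : X, edist x y = ⨅ γ : Path x y, eVariationOn γ Set.univ

/-- The Gromov product of `x` and `y` with base point `z`. -/
noncomputable def gromovProduct {X : Type*} [MetricSpace X] (x y z : X) : ℝ :=
  (dist x z + dist y z - dist x y) / 2

/-- `δ`-hyperbolicity, by the four points inequality. -/
def IsGromovHyperbolic (δ : ℝ) (X : Type*) [MetricSpace X] : Prop :=
  ∀ x y z t : X, min (gromovProduct x y t) (gromovProduct y z t) - δ ≤ gromovProduct x z t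

/-- A `σ`-rotation family of `G` acting on `X`: a collection of pairs (rotation group, apex). -/
structure IsRotationFamily {X G : Type*} [MetricSpace X] [Group G] [MulAction G X]
    (σ : ℝ) (R : Set (Subgroup G × X)) : Prop where
  pos : 0 < σ
  le_stabilizer : ∀ H v, (H, v) ∈ R → H ≤ MulAction.stabilizer G v
  large_angle : ∀ H v, (H, v) ∈ R → ∀ x ∈ Metric.closedBall v (σ / 10),
    ∀ h ∈ H, h ≠ 1 → dist (h • x) x = 2 * dist v x
  apices_apart : ∀ p ∈ R, ∀ q ∈ R, p ≠ q → σ ≤ dist p.2 q.2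
  invariant : ∀ (g : G) H v, (H, v) ∈ R →
    (H.map (MulAut.conj g).toMonoidHom, g • v) ∈ R

/-- The set of apices of `R`. -/
def apices {X G : Type*} [Group G] (R : Set (Subgroup G × X)) : Set X :=
  {v | ∃ H : Subgroup G, (H, v) ∈ R}

/-- The subgroup generated by all the rotation groups of `R`. -/
def rotationSubgroup {X G : Type*} [Group G] (R : Set (Subgroup G × X)) : Subgroup G :=
  Subgroup.closure {g | ∃ (H : Subgroup G) (v : X), (H, v) ∈ R ∧ g ∈ H}

/-- The subset `Y` is stable under the subgroup `K`, and every point of `Y` is the centre of a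
closed ball of `X`, of positive radius, that is disjoint from all its translates by nontrivial
elements of `K`. -/
def ActsFreelyDiscontinuouslyOn {X G : Type*} [MetricSpace X] [Group G] [MulAction G X]
    (K : Subgroup G) (Y : Set X) : Prop :=
  (∀ g ∈ K, ∀ x ∈ Y, g • x ∈ Y) ∧
  ∀ x ∈ Y, ∃ r : ℝ, 0 < r ∧ ∀ g ∈ K,
    (((fun y => g • y) '' Metric.closedBall x r) ∩ Metric.closedBall x r).Nonempty → g = 1

/-! The proof is a windmill argument with Gromov products in place of geodesics. A windmill `W` is a
quasi-convex set, stable under the group generated by the rotations around its apices, each element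
of which is a rotation or moves every point by at least `σ / 10`. A single apex is a windmill. To
enlarge `W`, add the apices within `36 * δ`, unfold by the rotations around all apices now present,
and thicken by `30 * δ` (`IsWindmill.next`).

An element of the new group is a word in rotations around the new apices, followed by an element of
the old group. Large angles (`IsWindmill.isTurning`) at centres `σ` apart make a reduced word trace
a path that cannot backtrack. This yields quasi-convexity of the unfolding, and large displacement
of cyclically reduced elements; the others are conjugate to shorter words, or are rotations.
Thickening resets the convexity constant to `2 * δ`, so the construction iterates and exhausts `X`.
Every nontrivial element of `K` is thus a rotation or moves all points far, which gives the
displacement bound. -/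

/-! ### Gromov products and quasi-convexity. -/

section GromovProduct

variable {X : Type*} [MetricSpace X] {δ : ℝ}

theorem gromovProduct_nonneg (x y z : X) : 0 ≤ gromovProduct x y z := by
  have h := dist_triangle_right x y z
  unfold gromovProduct
  linarith

theorem gromovProduct_comm (x y z : X) : gromovProduct x y z = gromovProduct y x z := by
  simp only [gromovProduct, dist_comm x y]
  ring

theorem gromovProduct_self_left (y z : X) : gromovProduct z y z = 0 := by
  simp [gromovProduct, dist_comm y z]

theorem gromovProduct_self_right (y z : X) : gromovProduct y z z = 0 := by
  simp [gromovProduct]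

theorem gromovProduct_add_rotate (x y z : X) :
    gromovProduct x y z + gromovProduct x z y = dist y z := by
  simp only [gromovProduct, dist_comm z y]
  ring

theorem gromovProduct_smul {G : Type*} [Group G] [MulAction G X] [IsIsometricSMul G X]
    (g : G) (x y z : X) :
    gromovProduct (g • x) (g • y) (g • z) = gromovProduct x y z := by
  simp only [gromovProduct, dist_smul]

theorem IsGromovHyperbolic.le_or_le (h : IsGromovHyperbolic δ X) (x y z t : X) :
    gromovProduct x y t ≤ gromovProduct x z t + δ ∨
      gromovProduct y z t ≤ gromovProduct x z t + δ := by
  have := h x y z t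
  rw [← min_le_iff]
  linarith

/-- In a length space there are points almost on a geodesic, at a prescribed distance from one of
its endpoints. -/
theorem IsLengthSpace.exists_between (hX : IsLengthSpace X) (x y : X) {t ε : ℝ} (ht : 0 ≤ t)
    (hty : t ≤ dist x y) (hε : 0 < ε) :
    ∃ z, dist x z = t ∧ dist z y < dist x y - t + ε := by
  have h1 : ⨅ γ : Path x y, eVariationOn γ Set.univ < ENNReal.ofReal (dist x y + ε) := by
    rw [← hX x y, edist_dist]
    exact (ENNReal.ofReal_lt_ofReal_iff (by positivity)).2 (by linarith)
  obtain ⟨γ, hγ⟩ := iInf_lt_iff.1 h1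
  obtain ⟨s, hs⟩ := mem_range_of_exists_le_of_exists_ge (c := t)
    (f := fun s => dist x (γ s)) (by fun_prop) ⟨0, by simpa using ht⟩ ⟨1, by simpa using hty⟩
  refine ⟨γ s, hs, ?_⟩
  have h2 : edist x (γ s) + edist (γ s) y ≤ eVariationOn γ Set.univ := by
    have ha := eVariationOn.edist_le γ (s := Set.Iic s) (x := 0) (y := s)
      (Set.mem_Iic.2 unitInterval.nonneg') (Set.mem_Iic.2 le_rfl)
    have hb := eVariationOn.edist_le γ (s := Set.Ici s) (x := s) (y := 1)
      (Set.mem_Ici.2 le_rfl) (Set.mem_Ici.2 unitInterval.le_one')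
    rw [γ.source] at ha
    rw [γ.target] at hb
    refine (add_le_add ha hb).trans ((eVariationOn.add_le_union γ ?_).trans
      (eVariationOn.mono γ (Set.subset_univ _)))
    intro a ha b hb
    exact le_trans (Set.mem_Iic.1 ha) (Set.mem_Ici.1 hb)
  have h3 := h2.trans_lt hγ
  rw [edist_dist, edist_dist, ← ENNReal.ofReal_add dist_nonneg dist_nonneg,
    ENNReal.ofReal_lt_ofReal_iff (by positivity)] at h3
  simp only at hs
  linarith

/-- A form of quasi-convexity that does not refer to geodesics: the Gromov product of two points of
`W` is bounded below by the distance to `W`, up to the constant `c`. -/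
def IsGromovConvex (c : ℝ) (W : Set X) : Prop :=
  ∀ a ∈ W, ∀ b ∈ W, ∀ (z : X) (ρ : ℝ), (∀ w ∈ W, ρ ≤ dist z w) → ρ - c ≤ gromovProduct a b z

/-- Distances to a thickening. -/
theorem IsLengthSpace.add_le_dist_of_le_dist_thickening (hX : IsLengthSpace X) {r ρ : ℝ}
    (hr : 0 < r) (hρ : 0 < ρ) {W : Set X} {z : X}
    (h : ∀ w ∈ Metric.thickening r W, ρ ≤ dist z w) {w : X} (hw : w ∈ W) : ρ + r ≤ dist z w := by
  by_contra! hlt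
  have hle : r ≤ dist w z := by
    by_contra! hwz
    have := h z (Metric.mem_thickening_iff.2 ⟨w, hw, by rwa [dist_comm]⟩)
    rw [dist_self] at this
    linarith
  rw [dist_comm] at hlt
  -- `e` is spent twice: to stay inside the thickening, and as the error of the almost geodesic.
  obtain ⟨e, he, her, he2⟩ : ∃ e, 0 < e ∧ e ≤ r ∧ 2 * e ≤ ρ + r - dist w z := by
    refine ⟨min r ((ρ + r - dist w z) / 2), lt_min hr (by linarith), min_le_left _ _, ?_⟩
    have := min_le_right r ((ρ + r - dist w z) / 2)
    linarith
  obtain ⟨y, hy1, hy2⟩ := hX.exists_between w z (t := r - e) (by linarith) (by linarith) he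
  have := h y (Metric.mem_thickening_iff.2 ⟨w, hw, by rw [dist_comm]; linarith⟩)
  rw [dist_comm] at this
  linarith

/-- Thickening by `r` gains `r` in the distance to `W`, which cancels the defect `r`. Only two uses
of hyperbolicity remain, so the new constant does not depend on `r`; this stops constants from
growing along the induction. -/
theorem IsGromovConvex.thickening (hX : IsLengthSpace X) (hδ : 0 < δ)
    (hhyp : IsGromovHyperbolic δ X) {r : ℝ} (hr : 0 < r) {W : Set X} (hW : IsGromovConvex r W) :
    IsGromovConvex (2 * δ) (Metric.thickening r W) := by
  intro a ha b hb z ρ hρ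
  rcases le_or_gt ρ 0 with h0 | h0
  · have := gromovProduct_nonneg a b z
    linarith
  have hfar := fun w hw => hX.add_le_dist_of_le_dist_thickening hr h0 hρ (w := w) hw
  have hnear : ∀ c ∈ Metric.thickening r W, ∀ d ∈ W, dist c d < r → ρ ≤ gromovProduct c d z := by
    intro c hc d hd hcd
    have h1 := hρ c hc
    have h2 := hfar d hd
    rw [dist_comm] at h1 h2
    unfold gromovProduct
    linarith
  obtain ⟨a', ha', haa'⟩ := Metric.mem_thickening_iff.1 ha
  obtain ⟨b', hb', hbb'⟩ := Metric.mem_thickening_iff.1 hb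
  have h1 := hnear a ha a' ha' haa'
  have h2 := hnear b hb b' hb' hbb'
  have h3 := hW a' ha' b' hb' z (ρ + r) hfar
  rw [gromovProduct_comm] at h2
  rcases hhyp.le_or_le a a' b z with h | h
  · linarith
  · rcases hhyp.le_or_le a' b' b z with h' | h' <;> linarith

end GromovProduct

/-! ### Paths unfolded by reduced words. -/

section Words

variable {X G : Type*}

/-- A word in the letters `T` is reduced if consecutive letters have distinct centres. -/
def IsReducedWord (T : Set (G × X)) (L : List (G × X)) : Prop :=
  (∀ p ∈ L, p ∈ T) ∧ L.IsChain fun p q => p.2 ≠ q.2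

theorem IsReducedWord.of_cons {T : Set (G × X)} {p : G × X} {L : List (G × X)}
    (h : IsReducedWord T (p :: L)) : IsReducedWord T L :=
  ⟨fun q hq => h.1 q (List.mem_cons_of_mem _ hq), (List.isChain_cons.1 h.2).2⟩

variable [Group G]

/-- The product of the group elements of a word. -/
def wordProd (L : List (G × X)) : G := (L.map Prod.fst).prod

@[simp] theorem wordProd_nil : wordProd ([] : List (G × X)) = 1 := rfl

@[simp] theorem wordProd_cons (p : G × X) (L : List (G × X)) :
    wordProd (p :: L) = p.1 * wordProd L := by
  simp [wordProd]

@[simp] theorem wordProd_append (L M : List (G × X)) :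
    wordProd (L ++ M) = wordProd L * wordProd M := by
  simp [wordProd]

variable [MulAction G X]

/-- The word obtained by translating all the apices, and conjugating all the rotations. -/
def conjWord (k : G) (L : List (G × X)) : List (G × X) :=
  L.map fun p => (k * p.1 * k⁻¹, k • p.2)

theorem wordProd_conjWord (k : G) (L : List (G × X)) :
    wordProd (conjWord k L) = k * wordProd L * k⁻¹ := by
  induction L with
  | nil => simp [conjWord]
  | cons p L ih =>
    have : conjWord k (p :: L) = (k * p.1 * k⁻¹, k • p.2) :: conjWord k L := rfl
    rw [this, wordProd_cons, wordProd_cons, ih]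
    group

variable [MetricSpace X] {δ σ : ℝ}

/-- Letters `(h, u)` such that `h` fixes `u` and opens a large angle at `u` between the points of
`Y` and their images. -/
structure IsTurning (δ σ : ℝ) (Y : Set X) (T : Set (G × X)) : Prop where
  center_mem : ∀ p ∈ T, p.2 ∈ Y
  fixed : ∀ p ∈ T, p.1 • p.2 = p.2
  turn : ∀ p ∈ T, ∀ a ∈ Y, ∀ b ∈ Y, gromovProduct a (p.1 • b) p.2 ≤ 2 * δ
  apart : ∀ p ∈ T, ∀ q ∈ T, p.2 ≠ q.2 → σ ≤ dist p.2 q.2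

variable [IsIsometricSMul G X] {Y : Set X} {T : Set (G × X)}

/-- A reduced word turns at its first centre. -/
theorem IsTurning.gromovProduct_wordProd_le (hhyp : IsGromovHyperbolic δ X)
    (hσ : 1000 * δ ≤ σ) (hδ : 0 < δ) (hT : IsTurning δ σ Y T) :
    ∀ (L : List (G × X)) (p : G × X), IsReducedWord T (p :: L) → ∀ a ∈ Y, ∀ b ∈ Y,
      gromovProduct a (wordProd (p :: L) • b) p.2 ≤ 3 * δ := by
  intro L
  induction L with
  | nil =>
    intro p hL a ha b hb
    have := hT.turn p (hL.1 p (by simp)) a ha b hb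
    simp only [wordProd_cons, wordProd_nil, mul_one]
    linarith
  | cons q L ih =>
    intro p hL a ha b hb
    have hp := hL.1 p (by simp)
    have hq := hL.1 q (by simp)
    have h1 := ih q hL.of_cons p.2 (hT.center_mem p hp) b hb
    have h2 := hT.apart p hp q hq (List.isChain_cons_cons.1 hL.2).1
    -- As the path turns at `q.2`, its endpoint and `q.2` are seen from `p.2` with product at least
    -- `σ - 3 * δ`. The endpoint thus inherits the bound `2 * δ` at the cost of one `δ`, and errors
    -- do not accumulate.
    have h3 := gromovProduct_add_rotate (wordProd (q :: L) • b) p.2 q.2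
    rw [gromovProduct_comm _ p.2] at h3
    have h4 := hT.turn p hp a ha q.2 (hT.center_mem q hq)
    rw [wordProd_cons, mul_smul]
    rw [← gromovProduct_smul p.1 _ q.2 p.2, hT.fixed p hp] at h3
    rcases hhyp.le_or_le a (p.1 • wordProd (q :: L) • b) (p.1 • q.2) p.2 with h | h <;> linarith

/-- Displacement grows linearly with the length of a reduced word. -/
theorem IsTurning.le_dist_wordProd (hhyp : IsGromovHyperbolic δ X)
    (hσ : 1000 * δ ≤ σ) (hδ : 0 < δ) (hT : IsTurning δ σ Y T) :
    ∀ (L : List (G × X)) (p : G × X), IsReducedWord T (p :: L) → ∀ a ∈ Y, ∀ b ∈ Y,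
      dist a p.2 + L.length * (σ - 6 * δ) - 6 * δ ≤ dist a (wordProd (p :: L) • b) := by
  intro L
  induction L with
  | nil =>
    intro p hL a ha b hb
    have h1 := hT.gromovProduct_wordProd_le hhyp hσ hδ [] p hL a ha b hb
    have h2 : 0 ≤ dist (wordProd [p] • b) p.2 := dist_nonneg
    unfold gromovProduct at h1
    simp only [List.length_nil, Nat.cast_zero]
    linarith
  | cons q L ih =>
    intro p hL a ha b hb
    have hp := hL.1 p (by simp)
    have hq := hL.1 q (by simp)
    have h1 := hT.gromovProduct_wordProd_le hhyp hσ hδ _ p hL a ha b hb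
    have h2 := hT.apart p hp q hq (List.isChain_cons_cons.1 hL.2).1
    have h3 := ih q hL.of_cons p.2 (hT.center_mem p hp) b hb
    have h4 : dist (wordProd (p :: q :: L) • b) p.2 = dist p.2 (wordProd (q :: L) • b) := by
      have h := dist_smul p.1 (wordProd (q :: L) • b) p.2
      rw [hT.fixed p hp] at h
      rw [wordProd_cons, mul_smul, h, dist_comm]
    unfold gromovProduct at h1
    push_cast [List.length_cons]
    linarith

/-- If the products seen from `z` of pairs of points in a common translate of `Y` are at least `D`,
then so are, up to `10 * δ`, those of the endpoints of the path unfolded by a reduced word. The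
point `y` is the start of a longer path of which `a` is an intermediate vertex. -/
theorem IsTurning.le_gromovProduct_wordProd_aux (hhyp : IsGromovHyperbolic δ X)
    (hσ : 1000 * δ ≤ σ) (hδ : 0 < δ) (hT : IsTurning δ σ Y T) {K : Subgroup G}
    (hK : ∀ p ∈ T, p.1 ∈ K) (D : ℝ) {b : X} (hb : b ∈ Y) :
    ∀ (L : List (G × X)), IsReducedWord T L → ∀ (y z : X), ∀ a ∈ Y,
      (∀ g ∈ K, ∀ c ∈ Y, ∀ d ∈ Y, D ≤ gromovProduct (g • c) (g • d) z) →
      gromovProduct y z a ≤ 5 * δ →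
      (∀ p ∈ L.head?, y = a ∨ σ ≤ dist a p.2 ∧ gromovProduct y p.2 a ≤ 3 * δ) →
      D - 10 * δ ≤ gromovProduct y (wordProd L • b) z := by
  intro L
  induction L with
  | nil =>
    intro _ y z a ha hD hyz _
    have h1 := hD 1 K.one_mem a ha b hb
    have h2 := dist_triangle y a b
    simp only [one_smul, wordProd_nil, gromovProduct, dist_comm z a] at *
    linarith
  | cons p L ih =>
    intro hL y z a ha hD hyz hhead
    have hp := hL.1 p (by simp)
    have hu := hT.center_mem p hp
    replace hhead := hhead p (by simp)
    have h1 := hT.gromovProduct_wordProd_le hhyp hσ hδ L p hL a ha b hb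
    -- Either `z` lies beyond `p.2`, and induction applies after translating by `p.1⁻¹`, or it lies
    -- before `p.2`, and the pair `a`, `p.2` gives the bound.
    rcases hhyp.le_or_le a z (wordProd (p :: L) • b) p.2 with h | h
    -- Seen from `p.2`, the point `y` is `a` or lies far behind it, so replacing `a` by `y` costs
    -- one `δ`.
    · have key : ∀ w, gromovProduct a w p.2 ≤ 4 * δ →
          gromovProduct y w p.2 ≤ gromovProduct a w p.2 + δ := by
        intro w hw
        rcases hhead with rfl | ⟨h2, h3⟩
        · linarith
        · have h4 := gromovProduct_add_rotate y p.2 a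
          rw [dist_comm] at h4
          rcases hhyp.le_or_le a y w p.2 with h5 | h5
          · rw [gromovProduct_comm] at h5
            linarith
          · exact h5
      rw [wordProd_cons, mul_smul, ← gromovProduct_smul p.1⁻¹, inv_smul_smul]
      refine ih hL.of_cons (p.1⁻¹ • y) (p.1⁻¹ • z) p.2 hu ?_ ?_ ?_
      · intro g hg c hc d hd
        rw [← gromovProduct_smul p.1, smul_inv_smul, ← mul_smul, ← mul_smul]
        exact hD _ (K.mul_mem (hK p hp) hg) c hc d hd
      · rw [← gromovProduct_smul p.1, smul_inv_smul, smul_inv_smul, hT.fixed p hp]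
        have := key z (by linarith)
        linarith
      · intro q hq
        have hqL : q ∈ L := List.mem_of_mem_head? hq
        have hqT := hL.1 q (List.mem_cons_of_mem _ hqL)
        right
        refine ⟨hT.apart p hp q hqT ((List.isChain_cons.1 hL.2).1 q hq), ?_⟩
        rw [← gromovProduct_smul p.1, smul_inv_smul, hT.fixed p hp]
        have h2 := hT.turn p hp a ha q.2 (hT.center_mem q hqT)
        have := key (p.1 • q.2) (by linarith)
        linarith
    · have h2 := hD 1 K.one_mem a ha p.2 hu
      have h3 := dist_triangle4 y a p.2 (wordProd (p :: L) • b)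
      simp only [one_smul, gromovProduct, dist_comm z a, dist_comm z p.2,
        dist_comm p.2 (wordProd (p :: L) • b), dist_comm z (wordProd (p :: L) • b)] at *
      linarith

theorem IsTurning.le_gromovProduct_wordProd (hhyp : IsGromovHyperbolic δ X)
    (hσ : 1000 * δ ≤ σ) (hδ : 0 < δ) (hT : IsTurning δ σ Y T) {K : Subgroup G}
    (hK : ∀ p ∈ T, p.1 ∈ K) {D : ℝ} {a b z : X} (ha : a ∈ Y) (hb : b ∈ Y)
    {L : List (G × X)} (hL : IsReducedWord T L)
    (hD : ∀ g ∈ K, ∀ c ∈ Y, ∀ d ∈ Y, D ≤ gromovProduct (g • c) (g • d) z) :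
    D - 10 * δ ≤ gromovProduct a (wordProd L • b) z :=
  hT.le_gromovProduct_wordProd_aux hhyp hσ hδ hK D hb L hL a z a ha hD
    (by rw [gromovProduct_self_left]; positivity) (fun _ _ => Or.inl rfl)

/-- Elements whose powers are represented by long reduced words have large displacement. -/
theorem IsTurning.le_dist_smul_of_cyclicallyReduced (hhyp : IsGromovHyperbolic δ X)
    (hσ : 1000 * δ ≤ σ) (hδ : 0 < δ) (hT : IsTurning δ σ Y T) {k : G}
    (hkY : ∀ y ∈ Y, k • y ∈ Y) (hkT : ∀ p ∈ T, (k * p.1 * k⁻¹, k • p.2) ∈ T)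
    {L : List (G × X)} {p : G × X} (hL : IsReducedWord T (p :: L))
    (hcyc : ∀ q ∈ (p :: L).getLast?, q.2 ≠ k • p.2) (x : X) :
    σ / 10 ≤ dist ((wordProd (p :: L) * k) • x) x := by
  set g := wordProd (p :: L) * k with hg
  -- Moving all the `k` to the right turns a power of `g` into a concatenation of conjugates of the
  -- word; `hcyc` keeps the junctions reduced.
  have hpow : ∀ n : ℕ, ∃ M : List (G × X), ∃ q : G × X, q.2 = p.2 ∧ IsReducedWord T (q :: M) ∧
      n ≤ M.length ∧ wordProd (q :: M) * k ^ (n + 1) = g ^ (n + 1) := by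
    intro n
    induction n with
    | zero => exact ⟨L, p, rfl, hL, Nat.zero_le _, by simp [hg]⟩
    | succ n ih =>
      obtain ⟨M, q, hq, hM, hn, hprod⟩ := ih
      refine ⟨L ++ conjWord k (q :: M), p, rfl, ⟨?_, ?_⟩, ?_, ?_⟩
      · intro r hr
        rw [← List.cons_append, List.mem_append] at hr
        rcases hr with hr | hr
        · exact hL.1 r hr
        · obtain ⟨s, hs, rfl⟩ := List.mem_map.1 hr
          exact hkT s (hM.1 s hs)
      · rw [← List.cons_append, List.isChain_append]
        refine ⟨hL.2, ?_, ?_⟩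
        · rw [conjWord, List.isChain_map]
          exact hM.2.imp fun r s hrs h => hrs (smul_left_cancel k h)
        · intro r hr s hs
          simp only [conjWord, List.map_cons, List.head?_cons, Option.mem_some_iff] at hs
          rw [← hs, hq]
          exact hcyc r hr
      · simp only [conjWord, List.length_append, List.length_map, List.length_cons]
        omega
      · rw [← List.cons_append, wordProd_append, wordProd_conjWord, pow_succ' g, ← hprod,
          pow_succ' k (n + 1), hg]
        group
  have hlin : ∀ n : ℕ, dist (g ^ n • x) x ≤ n * dist (g • x) x := by
    intro n
    induction n with
    | zero => simp
    | succ n ih =>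
      have h1 := dist_triangle (g ^ (n + 1) • x) (g ^ n • x) x
      rw [pow_succ, mul_smul, dist_smul] at h1
      rw [pow_succ, mul_smul]
      push_cast
      linarith
  have hpY := hT.center_mem p (hL.1 p (by simp))
  have hkn : ∀ n : ℕ, k ^ n • p.2 ∈ Y := by
    intro n
    induction n with
    | zero => simpa using hpY
    | succ n ih => rw [pow_succ', mul_smul]; exact hkY _ ih
  by_contra! hlt
  -- Under `g ^ (n + 1)`, `p.2` moves at rate at least `σ - 6 * δ`, but `x` at rate below `σ / 10`;
  -- their displacements differ by a bounded amount.
  have hbound : ∀ n : ℕ, n * (σ - 6 * δ - σ / 10) ≤ σ + 6 * δ + 2 * dist x p.2 := by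
    intro n
    obtain ⟨M, q, hq, hM, hn, hprod⟩ := hpow n
    have h1 := hT.le_dist_wordProd hhyp hσ hδ M q hM p.2 hpY _ (hkn (n + 1))
    rw [← mul_smul, hprod] at h1
    have h2 := hlin (n + 1)
    have h3 := dist_triangle4 p.2 x (g ^ (n + 1) • x) (g ^ (n + 1) • p.2)
    rw [dist_smul, dist_comm p.2 x, dist_comm x (g ^ (n + 1) • x)] at h3
    have h4 : (n : ℝ) * (σ - 6 * δ) ≤ M.length * (σ - 6 * δ) :=
      mul_le_mul_of_nonneg_right (by exact_mod_cast hn) (by linarith)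
    have h5 : ((n : ℝ) + 1) * dist (g • x) x ≤ (n + 1) * (σ / 10) :=
      mul_le_mul_of_nonneg_left hlt.le (by positivity)
    have h6 : 0 ≤ dist p.2 q.2 := dist_nonneg
    push_cast at h2
    linarith
  obtain ⟨n, hn⟩ := exists_nat_gt ((σ + 6 * δ + 2 * dist x p.2) / (σ - 6 * δ - σ / 10))
  rw [div_lt_iff₀ (by linarith)] at hn
  exact absurd (hbound n) (not_le.2 hn)

end Words

/-! ### Rotations and their displacement. -/

section RotationFamily

variable {X G : Type*} [Group G] {R : Set (Subgroup G × X)}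

/-- `g` belongs to the rotation group of the apex `v`. -/
def IsRotation (R : Set (Subgroup G × X)) (v : X) (g : G) : Prop :=
  ∃ H : Subgroup G, (H, v) ∈ R ∧ g ∈ H

theorem IsRotation.mem_apices {v : X} {g : G} (h : IsRotation R v g) : v ∈ apices R :=
  h.imp fun _ hH => hH.1

theorem isRotation_one {v : X} (h : v ∈ apices R) : IsRotation R v (1 : G) :=
  h.imp fun H hH => ⟨hH, H.one_mem⟩

theorem IsRotation.inv {v : X} {g : G} (h : IsRotation R v g) : IsRotation R v g⁻¹ :=
  h.imp fun H hH => ⟨hH.1, H.inv_mem hH.2⟩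

/-- The subgroup generated by the rotations around the apices of `W`. -/
def localRotationSubgroup (R : Set (Subgroup G × X)) (W : Set X) : Subgroup G :=
  Subgroup.closure {g | ∃ v ∈ W, IsRotation R v g}

theorem IsRotation.mem_localRotationSubgroup {W : Set X} {v : X} {g : G} (h : IsRotation R v g)
    (hv : v ∈ W) : g ∈ localRotationSubgroup R W :=
  Subgroup.subset_closure ⟨v, hv, h⟩

theorem localRotationSubgroup_mono {W W' : Set X} (h : W ⊆ W') :
    localRotationSubgroup R W ≤ localRotationSubgroup R W' :=
  Subgroup.closure_mono fun _ ⟨v, hv, hg⟩ => ⟨v, h hv, hg⟩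

variable [MetricSpace X] [MulAction G X] {δ σ : ℝ}

theorem IsRotation.conj (hR : IsRotationFamily σ R) (k : G) {v : X} {g : G}
    (h : IsRotation R v g) : IsRotation R (k • v) (k * g * k⁻¹) := by
  obtain ⟨H, hH, hg⟩ := h
  exact ⟨_, hR.invariant k H v hH, Subgroup.mem_map.2 ⟨g, hg, by simp [MulAut.conj_apply]⟩⟩

theorem IsRotationFamily.smul_mem_apices (hR : IsRotationFamily σ R) (k : G) {v : X}
    (h : v ∈ apices R) : k • v ∈ apices R :=
  ((isRotation_one h).conj hR k).mem_apices

theorem IsRotation.smul_eq (hR : IsRotationFamily σ R) {v : X} {g : G} (h : IsRotation R v g) :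
    g • v = v := by
  obtain ⟨H, hH, hg⟩ := h
  exact hR.le_stabilizer H v hH hg

theorem IsRotationFamily.le_dist (hR : IsRotationFamily σ R) {v w : X} (hv : v ∈ apices R)
    (hw : w ∈ apices R) (h : v ≠ w) : σ ≤ dist v w := by
  obtain ⟨H, hH⟩ := hv
  obtain ⟨H', hH'⟩ := hw
  exact hR.apices_apart _ hH _ hH' fun e => h (congrArg Prod.snd e)

theorem IsRotation.mul (hR : IsRotationFamily σ R) {v : X} {g h : G} (hg : IsRotation R v g)
    (hh : IsRotation R v h) : IsRotation R v (g * h) := by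
  obtain ⟨H, hH, hg⟩ := hg
  obtain ⟨H', hH', hh⟩ := hh
  have : H = H' := by
    by_contra hne
    have := hR.apices_apart _ hH _ hH' fun e => hne (congrArg Prod.fst e)
    rw [dist_self] at this
    exact absurd hR.pos (not_lt.2 this)
  subst this
  exact ⟨H, hH, H.mul_mem hg hh⟩

theorem IsRotation.gromovProduct_eq_zero [IsIsometricSMul G X] (hR : IsRotationFamily σ R)
    {v x : X} {g : G} (hg : IsRotation R v g) (hg1 : g ≠ 1) (hx : dist x v ≤ σ / 10) :
    gromovProduct x (g • x) v = 0 := by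
  have hfix := hg.smul_eq hR
  obtain ⟨H, hH, hgH⟩ := hg
  have h1 := hR.large_angle H v hH x (Metric.mem_closedBall.2 hx) g hgH hg1
  have h2 := dist_smul g x v
  rw [hfix] at h2
  rw [gromovProduct, h2, dist_comm x, dist_comm x, h1]
  ring

/-- A point `y` at distance `σ / 10` from `v` almost towards `x` has zero product with its image.
Since `x` and `y` are seen from `v` in nearly the same direction, `x` and `g • x` have product at
most `2 * δ`. -/
theorem IsRotation.le_dist_of_far [IsIsometricSMul G X] (hX : IsLengthSpace X)
    (hhyp : IsGromovHyperbolic δ X) (hδ : 0 < δ) (hσ : 1000 * δ ≤ σ) (hR : IsRotationFamily σ R)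
    {v x : X} {g : G} (hg : IsRotation R v g) (hg1 : g ≠ 1) (hx : σ / 10 ≤ dist v x) :
    σ / 10 ≤ dist (g • x) x := by
  obtain ⟨y, hy1, hy2⟩ := hX.exists_between v x (by linarith) hx hδ
  have h1 := hg.gromovProduct_eq_zero hR hg1 (x := y) (by rw [dist_comm, hy1])
  have h2 := gromovProduct_smul g x y v
  rw [hg.smul_eq hR] at h2
  have h3 : σ / 10 - δ ≤ gromovProduct y x v := by
    rw [gromovProduct, dist_comm y v, dist_comm x v]
    linarith
  have h4 : gromovProduct x (g • x) v ≤ 2 * δ := by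
    rcases hhyp.le_or_le y x (g • y) v with h | h
    · linarith
    · rcases hhyp.le_or_le x (g • x) (g • y) v with h' | h'
      · linarith
      · rw [h2, gromovProduct_comm] at h'
        linarith
  have h5 := dist_smul g x v
  rw [hg.smul_eq hR] at h5
  rw [gromovProduct, h5, dist_comm x v, dist_comm x] at h4
  linarith

/-- `g` is a rotation around some apex, or moves every point by at least `σ / 10`. -/
def IsRotationOrMoving (R : Set (Subgroup G × X)) (σ : ℝ) (g : G) : Prop :=
  (∃ v, IsRotation R v g) ∨ ∀ x : X, σ / 10 ≤ dist (g • x) x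

theorem IsRotationOrMoving.conj [IsIsometricSMul G X] (hR : IsRotationFamily σ R) (k : G) {g : G}
    (h : IsRotationOrMoving R σ g) : IsRotationOrMoving R σ (k * g * k⁻¹) := by
  rcases h with ⟨v, hv⟩ | h
  · exact Or.inl ⟨_, hv.conj hR k⟩
  · refine Or.inr fun x => ?_
    rw [← dist_smul k⁻¹, ← mul_smul, mul_assoc, inv_mul_cancel_left, mul_smul]
    exact h _

/-! ### Windmills and their enlargement. -/

/-- A set of points, quasi-convex, stable under the rotations around its apices and away from the
other apices, for which these rotations generate a group of rotations and of elements that move all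
points. -/
structure IsWindmill (δ σ : ℝ) (R : Set (Subgroup G × X)) (W : Set X) : Prop where
  convex : IsGromovConvex (2 * δ) W
  smul_mem : ∀ g ∈ localRotationSubgroup R W, ∀ w ∈ W, g • w ∈ W
  mem_of_near : ∀ v ∈ apices R, ∀ w ∈ W, dist v w < 6 * δ → v ∈ W
  isRotationOrMoving : ∀ g ∈ localRotationSubgroup R W, IsRotationOrMoving R σ g

theorem isWindmill_singleton (hδ : 0 < δ) (hσ : 1000 * δ ≤ σ) (hR : IsRotationFamily σ R) {v : X}
    (hv : v ∈ apices R) : IsWindmill δ σ R {v} := by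
  have hrot : ∀ g ∈ localRotationSubgroup R {v}, IsRotation R v g := by
    intro g hg
    induction hg using Subgroup.closure_induction with
    | mem x hx =>
      obtain ⟨w, rfl, hx⟩ := hx
      exact hx
    | one => exact isRotation_one hv
    | mul x y _ _ hx hy => exact hx.mul hR hy
    | inv x _ hx => exact hx.inv
  refine ⟨?_, ?_, ?_, fun g hg => Or.inl ⟨v, hrot g hg⟩⟩
  · intro a ha b hb z ρ hρ
    have := hρ v rfl
    rw [Set.mem_singleton_iff.1 ha, Set.mem_singleton_iff.1 hb, gromovProduct, dist_self, dist_comm v z]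
    linarith
  · rintro g hg w rfl
    exact (hrot g hg).smul_eq hR
  · rintro u hu w rfl huw
    by_contra hne
    have := hR.le_dist hu hv hne
    linarith

/-- The apices outside `W` that are not far from `W`. -/
def newApices (δ : ℝ) (R : Set (Subgroup G × X)) (W : Set X) : Set X :=
  {u | u ∈ apices R ∧ u ∉ W ∧ ∃ w ∈ W, dist u w < 36 * δ}

/-- The set `W` together with its new apices. -/
def enlargement (δ : ℝ) (R : Set (Subgroup G × X)) (W : Set X) : Set X :=
  W ∪ newApices δ R W

/-- The union of the translates of the enlargement of `W` by the rotations around its apices. -/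
def unfolding (δ : ℝ) (R : Set (Subgroup G × X)) (W : Set X) : Set X :=
  {y | ∃ g ∈ localRotationSubgroup R (enlargement δ R W), ∃ c ∈ enlargement δ R W, y = g • c}

/-- The nontrivial rotations around the new apices, with their centres. -/
def newRotations (δ : ℝ) (R : Set (Subgroup G × X)) (W : Set X) : Set (G × X) :=
  {p | p.2 ∈ newApices δ R W ∧ IsRotation R p.2 p.1 ∧ p.1 ≠ 1}

theorem enlargement_subset_unfolding (W : Set X) :
    enlargement δ R W ⊆ unfolding δ R W :=
  fun c hc => ⟨1, Subgroup.one_mem _, c, hc, (one_smul G c).symm⟩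

theorem smul_mem_unfolding {W : Set X} {g : G}
    (hg : g ∈ localRotationSubgroup R (enlargement δ R W)) {y : X} (hy : y ∈ unfolding δ R W) :
    g • y ∈ unfolding δ R W := by
  obtain ⟨k, hk, c, hc, rfl⟩ := hy
  exact ⟨g * k, Subgroup.mul_mem _ hg hk, c, hc, (mul_smul _ _ _).symm⟩

namespace IsWindmill

variable {W : Set X}

theorem le_dist_of_mem_newApices (hW : IsWindmill δ σ R W) {u : X}
    (hu : u ∈ newApices δ R W) : ∀ w ∈ W, 6 * δ ≤ dist u w := by
  intro w hw
  by_contra! h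
  exact hu.2.1 (hW.mem_of_near u hu.1 w hw h)

/-- The enlargement of a windmill is quasi-convex relatively to any larger set. -/
theorem le_gromovProduct_of_mem_enlargement (hW : IsWindmill δ σ R W)
    (hhyp : IsGromovHyperbolic δ X) (hδ : 0 < δ) {a b z : X} {ρ : ℝ}
    (ha : a ∈ enlargement δ R W) (hb : b ∈ enlargement δ R W)
    (hρ : ∀ w ∈ enlargement δ R W, ρ ≤ dist z w) : ρ - 20 * δ ≤ gromovProduct a b z := by
  -- `18` is half of the radius `36` of the enlargement; two uses of hyperbolicity then give `20`.
  have hnear : ∀ c ∈ enlargement δ R W, ∃ d ∈ W, ρ - 18 * δ ≤ gromovProduct c d z := by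
    intro c hc
    have h1 := hρ c hc
    obtain ⟨d, hd, hcd⟩ : ∃ d ∈ W, dist c d < 36 * δ := by
      rcases hc with hc | hc
      · exact ⟨c, hc, by rw [dist_self]; positivity⟩
      · exact hc.2.2
    have h2 := hρ d (Or.inl hd)
    refine ⟨d, hd, ?_⟩
    rw [gromovProduct, dist_comm c z, dist_comm d z]
    linarith
  obtain ⟨a', ha', h1⟩ := hnear a ha
  obtain ⟨b', hb', h2⟩ := hnear b hb
  have h3 := hW.convex a' ha' b' hb' z ρ fun w hw => hρ w (Or.inl hw)
  rw [gromovProduct_comm] at h2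
  rcases hhyp.le_or_le a a' b z with h | h
  · linarith
  · rcases hhyp.le_or_le a' b' b z with h' | h' <;> linarith

/-- Words in rotations around the new apices, not necessarily reduced, can be reduced. -/
theorem exists_shorter_word (hR : IsRotationFamily σ R) :
    ∀ L : List (G × X), (∀ p ∈ L, p.2 ∈ newApices δ R W ∧ IsRotation R p.2 p.1) →
      ¬ IsReducedWord (newRotations δ R W) L →
      ∃ M : List (G × X), (∀ p ∈ M, p.2 ∈ newApices δ R W ∧ IsRotation R p.2 p.1) ∧
        M.length < L.length ∧ wordProd M = wordProd L := by
  intro L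
  induction L with
  | nil => exact fun _ h => absurd ⟨by simp, List.isChain_nil⟩ h
  | cons p L ih =>
    intro hL hred
    have hL' : ∀ q ∈ L, q.2 ∈ newApices δ R W ∧ IsRotation R q.2 q.1 :=
      fun q hq => hL q (List.mem_cons_of_mem _ hq)
    have hp := hL p (by simp)
    by_cases h : IsReducedWord (newRotations δ R W) L
    · by_cases hp1 : p.1 = 1
      · exact ⟨L, hL', by simp, by simp [hp1]⟩
      · match L, h, hL', hred with
        | [], _, _, hred =>
          refine absurd ⟨?_, List.isChain_singleton p⟩ hred
          intro q hq
          rw [List.mem_singleton.1 hq]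
          exact ⟨hp.1, hp.2, hp1⟩
        | q :: L, h, hL', hred =>
          have hpq : p.2 = q.2 := by
            by_contra hpq
            refine hred ⟨?_, List.isChain_cons_cons.2 ⟨hpq, h.2⟩⟩
            intro r hr
            rcases List.mem_cons.1 hr with rfl | hr
            · exact ⟨hp.1, hp.2, hp1⟩
            · exact h.1 r hr
          refine ⟨(p.1 * q.1, p.2) :: L, ?_, by simp, by simp [mul_assoc]⟩
          intro r hr
          rcases List.mem_cons.1 hr with rfl | hr
          · exact ⟨hp.1, hp.2.mul hR (hpq ▸ (hL' q (by simp)).2)⟩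
          · exact hL' r (List.mem_cons_of_mem _ hr)
    · obtain ⟨M, hM, hlen, hprod⟩ := ih hL' h
      refine ⟨p :: M, ?_, by simpa using hlen, by simp [hprod]⟩
      intro q hq
      rcases List.mem_cons.1 hq with rfl | hq
      · exact hp
      · exact hM q hq

theorem exists_reducedWord (hR : IsRotationFamily σ R) (L : List (G × X))
    (hL : ∀ p ∈ L, p.2 ∈ newApices δ R W ∧ IsRotation R p.2 p.1) :
    ∃ M, IsReducedWord (newRotations δ R W) M ∧ wordProd M = wordProd L := by
  induction hn : L.length using Nat.strong_induction_on generalizing L with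
  | _ n ih =>
    by_cases h : IsReducedWord (newRotations δ R W) L
    · exact ⟨L, h, rfl⟩
    · obtain ⟨M, hM, hlen, hprod⟩ := exists_shorter_word hR L hL h
      obtain ⟨N, hN, hN'⟩ := ih M.length (hn ▸ hlen) M hM rfl
      exact ⟨N, hN, hN'.trans hprod⟩

variable [IsIsometricSMul G X]

theorem smul_mem_newApices (hW : IsWindmill δ σ R W) (hR : IsRotationFamily σ R) {k : G}
    (hk : k ∈ localRotationSubgroup R W) {u : X} (hu : u ∈ newApices δ R W) :
    k • u ∈ newApices δ R W := by
  obtain ⟨h1, h2, w, hw, h3⟩ := hu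
  refine ⟨hR.smul_mem_apices k h1, fun h => h2 ?_, k • w, hW.smul_mem k hk w hw, ?_⟩
  · simpa using hW.smul_mem k⁻¹ (Subgroup.inv_mem _ hk) _ h
  · rwa [dist_smul]

theorem smul_mem_enlargement (hW : IsWindmill δ σ R W) (hR : IsRotationFamily σ R) {k : G}
    (hk : k ∈ localRotationSubgroup R W) {y : X} (hy : y ∈ enlargement δ R W) :
    k • y ∈ enlargement δ R W :=
  hy.imp (hW.smul_mem k hk y) (hW.smul_mem_newApices hR hk)

/-- Rotations around apices of `W` are pushed to the right by conjugating the letters, which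
permutes the new apices. -/
theorem exists_word (hW : IsWindmill δ σ R W) (hR : IsRotationFamily σ R) {g : G}
    (hg : g ∈ localRotationSubgroup R (enlargement δ R W)) :
    ∃ L : List (G × X), (∀ p ∈ L, p.2 ∈ newApices δ R W ∧ IsRotation R p.2 p.1) ∧
      ∃ k ∈ localRotationSubgroup R W, g = wordProd L * k := by
  have hgen : ∀ x y : G, (∃ v ∈ enlargement δ R W, IsRotation R v x) →
      (∃ L : List (G × X), (∀ p ∈ L, p.2 ∈ newApices δ R W ∧ IsRotation R p.2 p.1) ∧
        ∃ k ∈ localRotationSubgroup R W, y = wordProd L * k) →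
      ∃ L : List (G × X), (∀ p ∈ L, p.2 ∈ newApices δ R W ∧ IsRotation R p.2 p.1) ∧
        ∃ k ∈ localRotationSubgroup R W, x * y = wordProd L * k := by
    rintro x _ ⟨v, hv | hv, hx⟩ ⟨L, hL, k, hk, rfl⟩
    · have hxW := hx.mem_localRotationSubgroup hv
      refine ⟨conjWord x L, ?_, x * k, Subgroup.mul_mem _ hxW hk, ?_⟩
      · intro p hp
        obtain ⟨q, hq, rfl⟩ := List.mem_map.1 hp
        exact ⟨hW.smul_mem_newApices hR hxW (hL q hq).1, (hL q hq).2.conj hR x⟩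
      · rw [wordProd_conjWord]
        group
    · refine ⟨(x, v) :: L, ?_, k, hk, by simp [mul_assoc]⟩
      intro p hp
      rcases List.mem_cons.1 hp with rfl | hp
      · exact ⟨hv, hx⟩
      · exact hL p hp
  induction hg using Subgroup.closure_induction_left with
  | one => exact ⟨[], by simp, 1, Subgroup.one_mem _, by simp⟩
  | mul_left x hx y _ ih => exact hgen x y hx ih
  | inv_mul_cancel x hx y _ ih => exact hgen _ y (hx.imp fun v hv => ⟨hv.1, hv.2.inv⟩) ih

/-- The rotations around the new apices open large angles. -/
theorem isTurning (hW : IsWindmill δ σ R W) (hhyp : IsGromovHyperbolic δ X) (hδ : 0 < δ)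
    (hσ : 1000 * δ ≤ σ) (hR : IsRotationFamily σ R) :
    IsTurning δ σ (enlargement δ R W) (newRotations δ R W) where
  center_mem p hp := Or.inr hp.1
  fixed p hp := hp.2.1.smul_eq hR
  apart p hp q hq h := hR.le_dist hp.1.1 hq.1.1 h
  turn := by
    rintro ⟨h, u⟩ ⟨hu, hrot, h1⟩ a ha b hb
    simp only at hu hrot h1 ⊢
    have hfar := hW.le_dist_of_mem_newApices hu
    obtain ⟨q, hq, huq⟩ := hu.2.2
    -- The gap `6 * δ` loses `2 * δ` to convexity and `δ` to hyperbolicity; the remaining `3 * δ`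
    -- exceeds the `2 * δ` that would contradict the angle at `u`.
    have hside : ∀ y ∈ enlargement δ R W, y ≠ u → 3 * δ ≤ gromovProduct q y u := by
      intro y hy hyu
      rcases hy with hy | hy
      · have := hW.convex q hq y hy u (6 * δ) hfar
        linarith
      · obtain ⟨q', hq', hyq'⟩ := hy.2.2
        have h2 := hW.convex q hq q' hq' u (6 * δ) hfar
        have h3 := hR.le_dist hy.1 hu.1 hyu
        have h4 := dist_triangle_right y u q'
        have h5 : σ - 36 * δ ≤ gromovProduct q' y u := by
          rw [gromovProduct, dist_comm q' y, dist_comm q' u]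
          linarith
        rcases hhyp.le_or_le q q' y u with h | h <;> linarith
    have hfix := hrot.smul_eq hR
    by_cases hau : a = u
    · rw [hau, gromovProduct_self_left]
      positivity
    by_cases hbu : b = u
    · rw [hbu, hfix, gromovProduct_self_right]
      positivity
    have ha' := hside a ha hau
    have hb' := hside b hb hbu
    -- `q` lies in the range of the large angle condition because `36 * δ ≤ σ / 10`.
    have h0 := hrot.gromovProduct_eq_zero hR h1 (x := q) (by rw [dist_comm]; linarith)
    rw [← gromovProduct_smul h, hfix, gromovProduct_comm] at hb'
    rcases hhyp.le_or_le q a (h • q) u with h | h'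
    · linarith
    · rcases hhyp.le_or_le a (h • b) (h • q) u with h | h <;> linarith

/-- After translation by `g⁻¹`, the two points are joined by a reduced word, with `k • b` still in
the enlargement. The constant adds `20 * δ` for the enlargement and `10 * δ` for the word. -/
theorem isGromovConvex_unfolding (hW : IsWindmill δ σ R W) (hhyp : IsGromovHyperbolic δ X)
    (hδ : 0 < δ) (hσ : 1000 * δ ≤ σ) (hR : IsRotationFamily σ R) :
    IsGromovConvex (30 * δ) (unfolding δ R W) := by
  rintro _ ⟨g, hg, a, ha, rfl⟩ _ ⟨g', hg', b, hb, rfl⟩ z ρ hρ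
  obtain ⟨L₀, hL₀, k, hk, hword⟩ :=
    hW.exists_word hR (Subgroup.mul_mem _ (Subgroup.inv_mem _ hg) hg')
  obtain ⟨L, hL, hprod⟩ := exists_reducedWord hR L₀ hL₀
  have h1 := (hW.isTurning hhyp hδ hσ hR).le_gromovProduct_wordProd hhyp hσ hδ
    (K := localRotationSubgroup R (enlargement δ R W)) (D := ρ - 20 * δ) (z := g⁻¹ • z)
    (fun p hp => hp.2.1.mem_localRotationSubgroup (Or.inr hp.1)) ha
    (hW.smul_mem_enlargement hR hk hb) hL ?_
  · rw [hprod, ← mul_smul, ← hword, ← gromovProduct_smul g, ← mul_smul, mul_inv_cancel_left,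
      smul_inv_smul] at h1
    linarith
  · intro f hf c hc d hd
    rw [← gromovProduct_smul f⁻¹, inv_smul_smul, inv_smul_smul]
    refine hW.le_gromovProduct_of_mem_enlargement hhyp hδ hc hd fun w hw => ?_
    have := hρ _ ⟨g * f, Subgroup.mul_mem _ hg hf, w, hw, rfl⟩
    rwa [← dist_smul (g * f)⁻¹, inv_smul_smul, mul_inv_rev, mul_smul] at this

theorem mem_unfolding_of_near (hδ : 0 < δ) (hσ : 1000 * δ ≤ σ) (hR : IsRotationFamily σ R)
    {v y : X} (hv : v ∈ apices R) (hy : y ∈ unfolding δ R W) (hvy : dist v y < 36 * δ) :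
    v ∈ unfolding δ R W := by
  obtain ⟨g, hg, c, hc, rfl⟩ := hy
  have hgv : g⁻¹ • v ∈ enlargement δ R W := by
    have hap := hR.smul_mem_apices g⁻¹ hv
    rw [← dist_smul g⁻¹, inv_smul_smul] at hvy
    rcases hc with hc | hc
    · by_cases h : g⁻¹ • v ∈ W
      · exact Or.inl h
      · exact Or.inr ⟨hap, h, c, hc, hvy⟩
    · by_cases h : g⁻¹ • v = c
      · rw [h]
        exact Or.inr hc
      · have := hR.le_dist hap hc.1 h
        linarith
  exact ⟨g, hg, _, hgv, (smul_inv_smul g v).symm⟩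

/-- Apices of the thickening already lie in the unfolding, so their rotations are conjugates of
rotations around apices of the enlargement. -/
theorem localRotationSubgroup_thickening (hδ : 0 < δ) (hσ : 1000 * δ ≤ σ)
    (hR : IsRotationFamily σ R) :
    localRotationSubgroup R (Metric.thickening (30 * δ) (unfolding δ R W)) =
      localRotationSubgroup R (enlargement δ R W) := by
  refine le_antisymm ((Subgroup.closure_le _).2 ?_) (localRotationSubgroup_mono
    ((enlargement_subset_unfolding W).trans (Metric.self_subset_thickening (by positivity) _)))
  rintro h ⟨v, hv, hrot⟩
  obtain ⟨y, hy, hvy⟩ := Metric.mem_thickening_iff.1 hv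
  obtain ⟨g, hg, c, hc, rfl⟩ :=
    mem_unfolding_of_near hδ hσ hR hrot.mem_apices hy (by linarith)
  have h1 := hrot.conj hR g⁻¹
  rw [inv_smul_smul] at h1
  have h2 := Subgroup.mul_mem _ (Subgroup.mul_mem _ hg (h1.mem_localRotationSubgroup hc))
    (Subgroup.inv_mem _ hg)
  simpa [mul_assoc] using h2

theorem isRotation_of_smul_eq (hW : IsWindmill δ σ R W) (hX : IsLengthSpace X)
    (hhyp : IsGromovHyperbolic δ X) (hδ : 0 < δ) (hσ : 1000 * δ ≤ σ) (hR : IsRotationFamily σ R)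
    {k : G} (hk : k ∈ localRotationSubgroup R W) {u : X} (hu : u ∈ apices R) (hku : k • u = u) :
    IsRotation R u k := by
  rcases hW.isRotationOrMoving k hk with ⟨v, hv⟩ | h
  · by_cases hvu : v = u
    · exact hvu ▸ hv
    · by_cases hk1 : k = 1
      · exact hk1 ▸ isRotation_one hu
      · have h1 := hR.le_dist hv.mem_apices hu hvu
        have h2 := hv.le_dist_of_far hX hhyp hδ hσ hR hk1 (x := u) (by linarith)
        rw [hku, dist_self] at h2
        linarith
  · have := h u
    rw [hku, dist_self] at this
    linarith

/-- By induction on length. A reduced word that is not cyclically reduced ends at `k • p.2`: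
conjugation carries its first letter past `k` and merges it into the last one. If there is only one
letter, `k` fixes its centre and the product is a rotation. -/
theorem isRotationOrMoving_wordProd (hW : IsWindmill δ σ R W) (hX : IsLengthSpace X)
    (hhyp : IsGromovHyperbolic δ X) (hδ : 0 < δ) (hσ : 1000 * δ ≤ σ) (hR : IsRotationFamily σ R)
    {k : G} (hk : k ∈ localRotationSubgroup R W) (L : List (G × X))
    (hL : ∀ p ∈ L, p.2 ∈ newApices δ R W ∧ IsRotation R p.2 p.1) :
    IsRotationOrMoving R σ (wordProd L * k) := by
  induction hn : L.length using Nat.strong_induction_on generalizing L with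
  | _ n ih =>
    by_cases hred : IsReducedWord (newRotations δ R W) L
    swap
    · obtain ⟨M, hM, hlen, hprod⟩ := exists_shorter_word hR L hL hred
      rw [← hprod]
      exact ih M.length (hn ▸ hlen) M hM rfl
    match L, hL, hred, hn with
    | [], _, _, _ => simpa using hW.isRotationOrMoving k hk
    | p :: L, hL, hred, hn =>
      by_cases hcyc : ∀ q ∈ (p :: L).getLast?, q.2 ≠ k • p.2
      · refine Or.inr ((hW.isTurning hhyp hδ hσ hR).le_dist_smul_of_cyclicallyReduced hhyp hσ hδ
          (fun y hy => hW.smul_mem_enlargement hR hk hy) ?_ hred hcyc)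
        rintro q ⟨hq1, hq2, hq3⟩
        exact ⟨hW.smul_mem_newApices hR hk hq1, hq2.conj hR k, by simpa using hq3⟩
      · push Not at hcyc
        obtain ⟨q, hq, hqp⟩ := hcyc
        have hp := hL p (by simp)
        rcases List.eq_nil_or_concat L with rfl | ⟨M, r, rfl⟩
        · simp only [List.getLast?_singleton, Option.mem_some_iff] at hq
          subst hq
          have h1 := hW.isRotation_of_smul_eq hX hhyp hδ hσ hR hk hp.1.1 hqp.symm
          exact Or.inl ⟨p.2, by simpa using hp.2.mul hR h1⟩
        · have hrq : r = q := by
            rw [List.concat_eq_append, ← List.cons_append, List.getLast?_append] at hq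
            simpa using hq
          subst hrq
          have hr := hL r (by simp)
          have h1 := ih (M ++ [(r.1 * (k * p.1 * k⁻¹), r.2)]).length (by simp [← hn])
            (M ++ [(r.1 * (k * p.1 * k⁻¹), r.2)]) ?_ rfl
          · have h2 := h1.conj hR p.1
            convert h2 using 1
            simp [mul_assoc]
          · intro s hs
            rcases List.mem_append.1 hs with hs | hs
            · exact hL s (by simp [hs])
            · rw [List.mem_singleton.1 hs]
              exact ⟨hr.1, hr.2.mul hR (hqp ▸ hp.2.conj hR k)⟩

/-- A windmill extends to a larger one, which contains a neighbourhood of it of uniform size. -/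
theorem next (hW : IsWindmill δ σ R W) (hX : IsLengthSpace X)
    (hhyp : IsGromovHyperbolic δ X) (hδ : 0 < δ) (hσ : 1000 * δ ≤ σ) (hR : IsRotationFamily σ R) :
    IsWindmill δ σ R (Metric.thickening (30 * δ) (unfolding δ R W)) where
  convex := (hW.isGromovConvex_unfolding hhyp hδ hσ hR).thickening hX hδ hhyp (by positivity)
  smul_mem g hg w hw := by
    rw [localRotationSubgroup_thickening hδ hσ hR] at hg
    obtain ⟨y, hy, hwy⟩ := Metric.mem_thickening_iff.1 hw
    exact Metric.mem_thickening_iff.2 ⟨g • y, smul_mem_unfolding hg hy, by rwa [dist_smul]⟩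
  mem_of_near v hv w hw hvw := by
    obtain ⟨y, hy, hwy⟩ := Metric.mem_thickening_iff.1 hw
    -- `6 + 30 = 36`: the radius for new apices covers the gap and the thickening together.
    have := dist_triangle v w y
    exact Metric.self_subset_thickening (by positivity) _
      (mem_unfolding_of_near hδ hσ hR hv hy (by linarith))
  isRotationOrMoving g hg := by
    rw [localRotationSubgroup_thickening hδ hσ hR] at hg
    obtain ⟨L, hL, k, hk, rfl⟩ := hW.exists_word hR hg
    exact hW.isRotationOrMoving_wordProd hX hhyp hδ hσ hR hk L hL

end IsWindmill

/-- Points that are not apices stay away from all the apices. -/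
theorem IsRotationFamily.exists_pos_le_dist (hR : IsRotationFamily σ R) {x : X}
    (hx : x ∉ apices R) : ∃ l : ℝ, 0 < l ∧ ∀ v ∈ apices R, l ≤ dist x v := by
  have hpos := hR.pos
  by_cases h : ∃ v ∈ apices R, dist x v < σ / 2
  · obtain ⟨v, hv, hxv⟩ := h
    refine ⟨dist x v, dist_pos.2 fun e => hx (e ▸ hv), fun w hw => ?_⟩
    by_cases hvw : v = w
    · rw [hvw]
    · have h1 := hR.le_dist hv hw hvw
      have h2 := dist_triangle_left v w x
      linarith
  · push Not at h
    exact ⟨σ / 2, by positivity, h⟩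

/-! ### Exhaustion by windmills and the main theorem. -/

/-- An exhaustion of the space by windmills. -/
def windmillSeq (δ : ℝ) (R : Set (Subgroup G × X)) (v : X) : ℕ → Set X
  | 0 => {v}
  | n + 1 => Metric.thickening (30 * δ) (unfolding δ R (windmillSeq δ R v n))

theorem thickening_subset_windmillSeq_succ (v : X) (n : ℕ) :
    Metric.thickening (30 * δ) (windmillSeq δ R v n) ⊆ windmillSeq δ R v (n + 1) :=
  Metric.thickening_subset_of_subset _
    (Set.subset_union_left.trans (enlargement_subset_unfolding _))

theorem windmillSeq_mono (hδ : 0 < δ) (v : X) : Monotone (windmillSeq δ R v) :=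
  monotone_nat_of_le_succ fun n =>
    (Metric.self_subset_thickening (by positivity) _).trans (thickening_subset_windmillSeq_succ v n)

/-- Each stage contains the `30 * δ`-neighbourhood of the preceding one. Counting only `δ` per stage
leaves room for the error of almost geodesics. -/
theorem exists_mem_windmillSeq (hX : IsLengthSpace X) (hδ : 0 < δ) (v x : X) :
    ∃ n, x ∈ windmillSeq δ R v n := by
  have h : ∀ n : ℕ, ∀ x, dist v x ≤ n * δ → x ∈ windmillSeq δ R v n := by
    intro n
    induction n with
    | zero =>
      intro x hx
      rw [Nat.cast_zero, zero_mul] at hx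
      exact (dist_le_zero.1 hx).symm
    | succ n ih =>
      intro x hx
      push_cast at hx
      by_cases hn : dist v x ≤ n * δ
      · exact windmillSeq_mono hδ v n.le_succ (ih x hn)
      · obtain ⟨y, hy1, hy2⟩ := hX.exists_between v x (t := n * δ) (by positivity)
          (not_le.1 hn).le hδ
        refine thickening_subset_windmillSeq_succ v n
          (Metric.mem_thickening_iff.2 ⟨y, ih y hy1.le, ?_⟩)
        rw [dist_comm]
        linarith
  obtain ⟨n, hn⟩ := exists_nat_ge (dist v x / δ)
  exact ⟨n, h n x ((div_le_iff₀ hδ).1 hn)⟩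

variable [IsIsometricSMul G X]

theorem IsRotationFamily.isRotationOrMoving (hX : IsLengthSpace X)
    (hhyp : IsGromovHyperbolic δ X) (hδ : 0 < δ) (hσ : 1000 * δ ≤ σ) (hR : IsRotationFamily σ R)
    {g : G} (hg : g ∈ rotationSubgroup R) (hg1 : g ≠ 1) : IsRotationOrMoving R σ g := by
  -- A nontrivial `g` forces an apex to exist, from which the exhaustion starts.
  obtain ⟨v, hv⟩ : (apices R).Nonempty := by
    by_contra! hemp
    refine hg1 (Subgroup.mem_bot.1 ((Subgroup.closure_le ⊥).2 ?_ hg))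
    rintro h ⟨H, v, hH, -⟩
    exact absurd (show v ∈ apices R from ⟨H, hH⟩) (by simp [hemp])
  have hwind : ∀ n, IsWindmill δ σ R (windmillSeq δ R v n) := by
    intro n
    induction n with
    | zero => exact isWindmill_singleton hδ hσ hR hv
    | succ n ih => exact ih.next hX hhyp hδ hσ hR
  have hex : ∃ n, g ∈ localRotationSubgroup R (windmillSeq δ R v n) := by
    clear hg1
    induction hg using Subgroup.closure_induction with
    | mem x hx =>
      obtain ⟨H, w, hH, hx⟩ := hx
      obtain ⟨n, hn⟩ := exists_mem_windmillSeq (R := R) hX hδ v w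
      exact ⟨n, IsRotation.mem_localRotationSubgroup ⟨H, hH, hx⟩ hn⟩
    | one => exact ⟨0, Subgroup.one_mem _⟩
    | mul x y _ _ hx hy =>
      obtain ⟨m, hm⟩ := hx
      obtain ⟨n, hn⟩ := hy
      exact ⟨max m n, Subgroup.mul_mem _
        (localRotationSubgroup_mono (windmillSeq_mono hδ v (le_max_left m n)) hm)
        (localRotationSubgroup_mono (windmillSeq_mono hδ v (le_max_right m n)) hn)⟩
    | inv x _ hx => exact hx.imp fun n hn => Subgroup.inv_mem _ hn
  obtain ⟨n, hn⟩ := hex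
  exact (hwind n).isRotationOrMoving g hn

theorem IsRotationFamily.min_le_dist (hX : IsLengthSpace X)
    (hhyp : IsGromovHyperbolic δ X) (hδ : 0 < δ) (hσ : 1000 * δ ≤ σ) (hR : IsRotationFamily σ R)
    {l : ℝ} {x : X} (hx : ∀ v ∈ apices R, l ≤ dist x v) {g : G} (hg : g ∈ rotationSubgroup R)
    (hg1 : g ≠ 1) : min (2 * l) (σ / 10) ≤ dist (g • x) x := by
  rcases hR.isRotationOrMoving hX hhyp hδ hσ hg hg1 with ⟨v, hv⟩ | h
  · rcases le_total (dist v x) (σ / 10) with h | h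
    · have h1 := hx v hv.mem_apices
      obtain ⟨H, hH, hgH⟩ := hv
      rw [hR.large_angle H v hH x (Metric.mem_closedBall'.2 h) g hgH hg1]
      rw [dist_comm] at h1
      exact (min_le_left _ _).trans (by linarith)
    · exact (min_le_right _ _).trans (hv.le_dist_of_far hX hhyp hδ hσ hR hg1 h)
  · exact (min_le_right _ _).trans (h x)

end RotationFamily

theorem mainTheorem3 (δ : ℝ) (hδ : 0 < δ) :
    ∃ σ₀ : ℝ, 0 < σ₀ ∧
      ∀ (X : Type*) [MetricSpace X] (G : Type*) [Group G] [MulAction G X] [IsIsometricSMul G X],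
        IsLengthSpace X → IsGromovHyperbolic δ X →
        ∀ (σ : ℝ) (R : Set (Subgroup G × X)), σ₀ ≤ σ → IsRotationFamily σ R →
          (∀ l : ℝ, 0 ≤ l → ∀ x : X, (∀ v ∈ apices R, l ≤ dist x v) →
            ∀ g ∈ rotationSubgroup R, g ≠ 1 → min (2 * l) (σ / 10) ≤ dist (g • x) x) ∧
          ActsFreelyDiscontinuouslyOn (rotationSubgroup R) (apices R)ᶜ := by
  refine ⟨1000 * δ, by positivity, ?_⟩
  intro X _ G _ _ _ hX hhyp σ R hσ hR
  refine ⟨fun l _ x hx g hg hg1 => hR.min_le_dist hX hhyp hδ hσ hx hg hg1, ?_, ?_⟩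
  · intro g _ x hx h
    exact hx (by simpa using hR.smul_mem_apices g⁻¹ h)
  · intro x hx
    obtain ⟨l, hl, hxl⟩ := hR.exists_pos_le_dist hx
    have hm : 0 < min (2 * l) (σ / 10) := lt_min (by linarith) (by linarith [hR.pos])
    -- A common point of the ball and its translate gives displacement at most two thirds of the
    -- minimum.
    refine ⟨min (2 * l) (σ / 10) / 3, by positivity, ?_⟩
    rintro g hg ⟨_, ⟨y, hy, rfl⟩, hgy⟩
    by_contra hg1
    have h1 := hR.min_le_dist hX hhyp hδ hσ hxl hg hg1
    rw [Metric.mem_closedBall] at hy hgy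
    have h2 := dist_triangle (g • x) (g • y) x
    rw [dist_smul, dist_comm x y] at h2
    simp only at hgy
    linarith
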